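/- Consider the stochastic discrete-time system \[ x_{k+1}=A(w_k)x_k+B(w_k)u_k,\qquad A(w)=A_0+\sum_{i=1}^{d}w^{(i)}A_i,\quad B(w)=B_0+\sum_{i=1}^{d}w^{(i)}B_i, \] with $x_k\in\mathbb R^n$, $u_k\in\mathbb R^m$, and $(w_k)_{k\ge 0}$ i.i.d. square integrable random vectors in $\mathbb R^d$ with mean $\mu$ and covariance $\Sigma$. Put $\Sigma_0=\begin{bmatrix}1&\mu^\top\\ \mu&\Sigma+\mu\mu^\top\end{bmatrix}$, let $\mathbf A=[A_0^\top\ A_1^\top\cdots A_d^\top]^\top$ and $\mathbf B=[B_0^\top\ B_1^\top\cdots B_d^\top]^\top$, and define \[ F(P)=\mathbf A^\top(\Sigma_0\otimes P)\mathbf A,\quad G(P)=\mathbf B^\top(\Sigma_0\otimes P)\mathbf B,\quad H(P)=\mathbf B^\top(\Sigma_0\otimes P)\mathbf A . \] Let $Q\succ0$ and $R\succ0$. For an initial state $x_0\in\mathbb R^n$, the infinite-horizon LQR problem is to minimize $\mathbb E\big[\sum_{k=0}^{\infty}x_k^\top Qx_k+u_k^\top Ru_k\big]\in[0,\infty]$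 over all non-anticipative input processes $(u_k)$, that is, those for which there is a filtration $(\mathcal F_k)$ such that $u_k$ is $\mathcal F_k$-measurable, $w_k$ is $\mathcal F_{k+1}$-measurable and $\mathcal F_k$ is independent of $w_k$, for every $k$. Assume that the system is mean-square stabilizable: there are $K\in\mathbb R^{m\times n}$ and $P\succ0$ such that \[ P-(\mathbf A+\mathbf BK)^\top(\Sigma_0\otimes P)(\mathbf A+\mathbf BK)\succ0 . \] Then the Riccati equation \[ P=Q+F(P)-H(P)^\top\big(R+G(P)\big)^{-1}H(P) \] has a unique positive semidefinite solution $P_\infty$, it satisfies $P_\infty\succ0$, and with $K_\infty=-(R+G(P_\infty))^{-1}H(P_\infty)$ the following hold. (i) For every $x_0$, the linear state feedback $u_k=K_\infty x_k$ is an optimal solution of the LQR problem, and every optimal solution coincides with it almost surely at every time $k$. (ii) $K_\infty$ stabilizes the system in the mean-square sense: for every $x_0$, the closed loop $x_{k+1}=(A(w_k)+B(w_k)K_\infty)x_k$ satisfies $\mathbb E[x_k^\top x_k]\to0$ as $k\to\infty$; moreover, there is $P\succ0$ with $P-(\mathbf A+\mathbf BK_\infty)^\top(\Sigma_0\otimes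 P)(\mathbf A+\mathbf BK_\infty)\succ0$. (iii) $P_\infty$ is the unique optimal solution of the semidefinite program \[ \min_{P}\ -\operatorname{tr}P\quad\text{subject to}\quad \begin{bmatrix}Q-P+F(P)&H(P)^\top\\ H(P)&R+G(P)\end{bmatrix}\succeq0,\qquad P\succeq0 . \] -/

import Mathlib

open MeasureTheory ProbabilityTheory Filter Topology Matrix
open scoped ENNReal Kronecker

namespace MultNoise

/-- A matrix-valued affine function of the noise, `M₀ + ∑ i, v i • M i`. -/
def affine {d a b : ℕ} (M₀ : Matrix (Fin a) (Fin b) ℝ) (M : Fin d → Matrix (Fin a) (Fin b) ℝ)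
    (v : Fin d → ℝ) : Matrix (Fin a) (Fin b) ℝ :=
  M₀ + ∑ i, v i • M i

/-- The block column obtained by putting `M₀, M₁, …, M_d` below each other. -/
def stack {d a b : ℕ} (M₀ : Matrix (Fin a) (Fin b) ℝ) (M : Fin d → Matrix (Fin a) (Fin b) ℝ) :
    Matrix ((Unit ⊕ Fin d) × Fin a) (Fin b) ℝ :=
  Matrix.of fun p j => Sum.elim (fun _ => M₀) M p.1 p.2 j

/-- The mean vector of a law on `ℝ^d`. -/
noncomputable def mean {d : ℕ} (ν : Measure (Fin d → ℝ)) : Fin d → ℝ :=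
  fun i => ∫ v, v i ∂ν

/-- The covariance matrix of a law on `ℝ^d`. -/
noncomputable def covar {d : ℕ} (ν : Measure (Fin d → ℝ)) : Matrix (Fin d) (Fin d) ℝ :=
  Matrix.of fun i j => ∫ v, (v i - mean ν i) * (v j - mean ν j) ∂ν

/-- The extended second moment matrix `[1, μᵀ; μ, Σ + μ μᵀ]`. -/
noncomputable def extCovar {d : ℕ} (ν : Measure (Fin d → ℝ)) :
    Matrix (Unit ⊕ Fin d) (Unit ⊕ Fin d) ℝ :=
  Matrix.fromBlocks 1 (Matrix.replicateRow Unit (mean ν)) (Matrix.replicateCol Unit (mean ν))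
    (covar ν + Matrix.vecMulVec (mean ν) (mean ν))

/-- The coefficient matrices of the system `x⁺ = A(w) x + B(w) u` with
`A(w) = A₀ + ∑ i, w i • A i` and `B(w) = B₀ + ∑ i, w i • B i`. -/
structure Sys (n m d : ℕ) where
  A₀ : Matrix (Fin n) (Fin n) ℝ
  A : Fin d → Matrix (Fin n) (Fin n) ℝ
  B₀ : Matrix (Fin n) (Fin m) ℝ
  B : Fin d → Matrix (Fin n) (Fin m) ℝ

section Algebra

variable {n m d : ℕ}

/-- `F(P) = 𝐀ᵀ (Σ₀ ⊗ P) 𝐀`, with `𝐀` the block column of `A₀, …, A_d`. -/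
noncomputable def F (S : Sys n m d) (ν : Measure (Fin d → ℝ)) (P : Matrix (Fin n) (Fin n) ℝ) :
    Matrix (Fin n) (Fin n) ℝ :=
  (stack S.A₀ S.A)ᵀ * (extCovar ν ⊗ₖ P) * stack S.A₀ S.A

/-- `G(P) = 𝐁ᵀ (Σ₀ ⊗ P) 𝐁`. -/
noncomputable def G (S : Sys n m d) (ν : Measure (Fin d → ℝ)) (P : Matrix (Fin n) (Fin n) ℝ) :
    Matrix (Fin m) (Fin m) ℝ :=
  (stack S.B₀ S.B)ᵀ * (extCovar ν ⊗ₖ P) * stack S.B₀ S.B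

/-- `H(P) = 𝐁ᵀ (Σ₀ ⊗ P) 𝐀`. -/
noncomputable def H (S : Sys n m d) (ν : Measure (Fin d → ℝ)) (P : Matrix (Fin n) (Fin n) ℝ) :
    Matrix (Fin m) (Fin n) ℝ :=
  (stack S.B₀ S.B)ᵀ * (extCovar ν ⊗ₖ P) * stack S.A₀ S.A

/-- The Lyapunov condition `P ≻ 0`, `P - 𝐌ᵀ (Σ₀ ⊗ P) 𝐌 ≻ 0` for the autonomous system
`x⁺ = (M₀ + ∑ i, w i • M i) x`. -/
def Lyapunov (ν : Measure (Fin d → ℝ)) (M₀ : Matrix (Fin n) (Fin n) ℝ)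
    (M : Fin d → Matrix (Fin n) (Fin n) ℝ) (P : Matrix (Fin n) (Fin n) ℝ) : Prop :=
  P.PosDef ∧ (P - (stack M₀ M)ᵀ * (extCovar ν ⊗ₖ P) * stack M₀ M).PosDef

/-- The constant coefficient `A₀ + B₀ K` of the closed loop with gain `K`. -/
def Sys.cl₀ (S : Sys n m d) (K : Matrix (Fin m) (Fin n) ℝ) : Matrix (Fin n) (Fin n) ℝ :=
  S.A₀ + S.B₀ * K

/-- The noise coefficients `A i + B i K` of the closed loop with gain `K`. -/
def Sys.cl (S : Sys n m d) (K : Matrix (Fin m) (Fin n) ℝ) :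
    Fin d → Matrix (Fin n) (Fin n) ℝ :=
  fun i => S.A i + S.B i * K

/-- Mean square stabilizability: some gain makes the closed loop satisfy the Lyapunov condition. -/
def Stabilizable (S : Sys n m d) (ν : Measure (Fin d → ℝ)) : Prop :=
  ∃ K : Matrix (Fin m) (Fin n) ℝ, ∃ P, Lyapunov ν (S.cl₀ K) (S.cl K) P

/-- The generalized algebraic Riccati equation. -/
def Riccati (S : Sys n m d) (ν : Measure (Fin d → ℝ)) (Q : Matrix (Fin n) (Fin n) ℝ)
    (R : Matrix (Fin m) (Fin m) ℝ) (P : Matrix (Fin n) (Fin n) ℝ) : Prop :=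
  P = Q + F S ν P - (H S ν P)ᵀ * (R + G S ν P)⁻¹ * H S ν P

/-- The gain `-(R + G(P))⁻¹ H(P)`. -/
noncomputable def gain (S : Sys n m d) (ν : Measure (Fin d → ℝ)) (R : Matrix (Fin m) (Fin m) ℝ)
    (P : Matrix (Fin n) (Fin n) ℝ) : Matrix (Fin m) (Fin n) ℝ :=
  -((R + G S ν P)⁻¹ * H S ν P)

/-- The feasible set of the semidefinite program. -/
def sdpFeasible (S : Sys n m d) (ν : Measure (Fin d → ℝ)) (Q : Matrix (Fin n) (Fin n) ℝ)
    (R : Matrix (Fin m) (Fin m) ℝ) : Set (Matrix (Fin n) (Fin n) ℝ) :=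
  {P | (Matrix.fromBlocks (Q - P + F S ν P) (H S ν P)ᵀ (H S ν P) (R + G S ν P)).PosSemidef ∧
    P.PosSemidef}

/-- `P` is a minimizer of `-tr P` over the feasible set of the semidefinite program. -/
def IsSdpSolution (S : Sys n m d) (ν : Measure (Fin d → ℝ)) (Q : Matrix (Fin n) (Fin n) ℝ)
    (R : Matrix (Fin m) (Fin m) ℝ) (P : Matrix (Fin n) (Fin n) ℝ) : Prop :=
  P ∈ sdpFeasible S ν Q R ∧ IsMinOn (fun P' => -P'.trace) (sdpFeasible S ν Q R) P

end Algebra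

section Dynamics

variable {n m d : ℕ} {Ω : Type*}

/-- The trajectory of `x⁺ = A(w) x + B(w) u` from `x₀` under the input process `u`. -/
def Sys.state (S : Sys n m d) (w : ℕ → Ω → Fin d → ℝ) (x₀ : Fin n → ℝ)
    (u : ℕ → Ω → Fin m → ℝ) : ℕ → Ω → Fin n → ℝ
  | 0, _ => x₀
  | k + 1, ω => affine S.A₀ S.A (w k ω) *ᵥ S.state w x₀ u k ω + affine S.B₀ S.B (w k ω) *ᵥ u k ω

/-- The trajectory of the autonomous system `x⁺ = (M₀ + ∑ i, w i • M i) x` from `x₀`. -/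
def autState (M₀ : Matrix (Fin n) (Fin n) ℝ) (M : Fin d → Matrix (Fin n) (Fin n) ℝ)
    (w : ℕ → Ω → Fin d → ℝ) (x₀ : Fin n → ℝ) : ℕ → Ω → Fin n → ℝ
  | 0, _ => x₀
  | k + 1, ω => affine M₀ M (w k ω) *ᵥ autState M₀ M w x₀ k ω

/-- The input process `u k = K x k` generated by the linear state feedback `K` from `x₀`. -/
def Sys.feedback (S : Sys n m d) (w : ℕ → Ω → Fin d → ℝ) (K : Matrix (Fin m) (Fin n) ℝ)
    (x₀ : Fin n → ℝ) : ℕ → Ω → Fin m → ℝ :=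
  fun k ω => K *ᵥ autState (S.cl₀ K) (S.cl K) w x₀ k ω

theorem affine_cl (S : Sys n m d) (K : Matrix (Fin m) (Fin n) ℝ) (v : Fin d → ℝ) :
    affine (S.cl₀ K) (S.cl K) v = affine S.A₀ S.A v + affine S.B₀ S.B v * K := by
  simp only [affine, Sys.cl₀, Sys.cl, smul_add, Finset.sum_add_distrib, Matrix.add_mul,
    Matrix.sum_mul, Matrix.smul_mul]
  abel

/-- Under the input process `S.feedback w K x₀`, the trajectory is that of the closed loop, so
that this input really is `u k = K x k`. -/
theorem state_feedback (S : Sys n m d) (w : ℕ → Ω → Fin d → ℝ) (K : Matrix (Fin m) (Fin n) ℝ)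
    (x₀ : Fin n → ℝ) (k : ℕ) (ω : Ω) :
    S.state w x₀ (S.feedback w K x₀) k ω = autState (S.cl₀ K) (S.cl K) w x₀ k ω := by
  induction k with
  | zero => rfl
  | succ k ih =>
    simp only [Sys.state, autState, ih, affine_cl, Matrix.add_mulVec, Sys.feedback,
      Matrix.mulVec_mulVec]

variable [MeasurableSpace Ω]

/-- Mean square stability: `E[x_kᵀ x_k] → 0` from every initial state. -/
def MSStable (Pr : Measure Ω) (w : ℕ → Ω → Fin d → ℝ) (M₀ : Matrix (Fin n) (Fin n) ℝ)
    (M : Fin d → Matrix (Fin n) (Fin n) ℝ) : Prop :=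
  ∀ x₀ : Fin n → ℝ,
    Tendsto (fun k => ∫⁻ ω, ENNReal.ofReal
      (autState M₀ M w x₀ k ω ⬝ᵥ autState M₀ M w x₀ k ω) ∂Pr) atTop (𝓝 0)

/-- The expected infinite-horizon cost, in `[0, ∞]`. -/
noncomputable def cost (S : Sys n m d) (Pr : Measure Ω) (w : ℕ → Ω → Fin d → ℝ)
    (Q : Matrix (Fin n) (Fin n) ℝ) (R : Matrix (Fin m) (Fin m) ℝ) (x₀ : Fin n → ℝ)
    (u : ℕ → Ω → Fin m → ℝ) : ℝ≥0∞ :=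
  ∫⁻ ω, ∑' k, ENNReal.ofReal
    (S.state w x₀ u k ω ⬝ᵥ (Q *ᵥ S.state w x₀ u k ω) + u k ω ⬝ᵥ (R *ᵥ u k ω)) ∂Pr

/-- Non-anticipative input processes: `u k` is measurable with respect to information available
before `w k` is drawn. That information contains `w 0, …, w (k - 1)`, may contain additional
randomization, and is independent of `w k`. -/
def Admissible (Pr : Measure Ω) (w : ℕ → Ω → Fin d → ℝ) (u : ℕ → Ω → Fin m → ℝ) : Prop :=
  ∃ ℱ : Filtration ℕ (inferInstance : MeasurableSpace Ω),
    (∀ k, Measurable[ℱ (k + 1)] (w k)) ∧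
    (∀ k, Indep (ℱ k) (MeasurableSpace.comap (w k) inferInstance) Pr) ∧
    (∀ k, Measurable[ℱ k] (u k))

/-- `u` solves the infinite-horizon LQR problem from the initial state `x₀`. -/
def IsOptimal (S : Sys n m d) (Pr : Measure Ω) (w : ℕ → Ω → Fin d → ℝ)
    (Q : Matrix (Fin n) (Fin n) ℝ) (R : Matrix (Fin m) (Fin m) ℝ) (x₀ : Fin n → ℝ)
    (u : ℕ → Ω → Fin m → ℝ) : Prop :=
  Admissible Pr w u ∧ ∀ v, Admissible Pr w v → cost S Pr w Q R x₀ u ≤ cost S Pr w Q R x₀ v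

end Dynamics

end MultNoise

/-! For a state-input pair fixed before the noise is drawn, averaging `xᵀ P x` at the next state
gives a quadratic form with matrix `Σ₀ ⊗ P` (`integral_qf_blockSum`). Everything then reduces to the
deterministic one-step cost `oneStep`, and completing the square splits it into `riccatiMap` plus a
nonnegative gap that vanishes exactly at the gain (`oneStep_eq`).

The matrix inequality of the semidefinite program says that `P` is a subsolution: `xᵀ P x` is at
most the one-step cost for every input (`mem_sdpFeasible_iff`). Stabilizability bounds all
subsolutions, so the feasible set is compact and the trace has a maximizer. `riccatiMap` is monotone
and increases subsolutions, so the maximizer is a fixed point (`exists_riccati`). Since `Q ≻ 0`, any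
positive semidefinite solution is a Lyapunov matrix for its own closed loop; the comparison
principle `posSemidef_of_lyapunov` makes it the largest subsolution. This gives uniqueness and the
claim on the semidefinite program.

For the dynamics, the Bellman identity telescopes (`sum_stageCost_add_valueAt`). Finite cost and `Q
≻ 0` force the terminal value to `0`, so the cost is `x₀ᵀ P x₀` plus the sum of expected gaps
(`cost_eq`). The feedback has no gap, and an optimal input can have none. -/

namespace MultNoise

/-! ### Real quadratic forms. -/

section QuadraticForms

variable {ι κ : Type*} [Fintype ι] [Fintype κ]

/-- The quadratic form `xᵀ M x`. -/
def qf (M : Matrix ι ι ℝ) (x : ι → ℝ) : ℝ := x ⬝ᵥ (M *ᵥ x)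

theorem qf_add (M N : Matrix ι ι ℝ) (x : ι → ℝ) : qf (M + N) x = qf M x + qf N x := by
  simp [qf, Matrix.add_mulVec]

theorem qf_sub (M N : Matrix ι ι ℝ) (x : ι → ℝ) : qf (M - N) x = qf M x - qf N x := by
  simp [qf, Matrix.sub_mulVec]

theorem qf_smul (c : ℝ) (M : Matrix ι ι ℝ) (x : ι → ℝ) : qf (c • M) x = c * qf M x := by
  simp [qf, Matrix.smul_mulVec]

theorem qf_smul_vec (M : Matrix ι ι ℝ) (c : ℝ) (x : ι → ℝ) :
    qf M (c • x) = c ^ 2 * qf M x := by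
  simp [qf, Matrix.mulVec_smul]; ring

theorem qf_conj (M : Matrix ι ι ℝ) (C : Matrix ι κ ℝ) (x : κ → ℝ) :
    qf (Cᵀ * M * C) x = qf M (C *ᵥ x) := by
  simp only [qf, ← Matrix.mulVec_mulVec, Matrix.dotProduct_mulVec x, Matrix.vecMul_transpose]

theorem qf_add_vec {M : Matrix ι ι ℝ} (hM : M.IsHermitian) (x y : ι → ℝ) :
    qf M (x + y) = qf M x + 2 * (y ⬝ᵥ (M *ᵥ x)) + qf M y := by
  have h : x ⬝ᵥ (M *ᵥ y) = y ⬝ᵥ (M *ᵥ x) := by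
    rw [Matrix.dotProduct_mulVec, dotProduct_comm, ← Matrix.mulVec_transpose,
      ← Matrix.conjTranspose_eq_transpose_of_trivial, hM.eq]
  simp only [qf, Matrix.mulVec_add, dotProduct_add, add_dotProduct, h]
  ring

theorem continuous_qf (M : Matrix ι ι ℝ) : Continuous (qf M) := by
  unfold qf; fun_prop

theorem posSemidef_iff_qf {M : Matrix ι ι ℝ} :
    M.PosSemidef ↔ M.IsHermitian ∧ ∀ x, 0 ≤ qf M x := by
  simp [Matrix.posSemidef_iff_dotProduct_mulVec, qf]

theorem posDef_iff_qf {M : Matrix ι ι ℝ} :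
    M.PosDef ↔ M.IsHermitian ∧ ∀ x, x ≠ 0 → 0 < qf M x := by
  simp [Matrix.posDef_iff_dotProduct_mulVec, qf]

theorem qf_nonneg {M : Matrix ι ι ℝ} (hM : M.PosSemidef) (x : ι → ℝ) : 0 ≤ qf M x :=
  (posSemidef_iff_qf.1 hM).2 x

/-- A quadratic form is bounded by a multiple of any positive definite one. -/
theorem exists_qf_le {M : Matrix ι ι ℝ} (hM : M.PosDef) (N : Matrix ι ι ℝ) :
    ∃ c : ℝ, 1 ≤ c ∧ ∀ x, qf N x ≤ c * qf M x := by
  have hpos := (posDef_iff_qf.1 hM).2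
  have hc : ContinuousOn (fun x => qf N x / qf M x) (Metric.sphere (0 : ι → ℝ) 1) := by
    refine (continuous_qf N).continuousOn.div (continuous_qf M).continuousOn fun x hx => ?_
    exact (hpos x (ne_zero_of_mem_unit_sphere ⟨x, hx⟩)).ne'
  obtain ⟨C, hC⟩ := ((isCompact_sphere (0 : ι → ℝ) 1).image_of_continuousOn hc).bddAbove
  -- The ratio of the forms is scale invariant, so its bound on the unit sphere is global. Taking `c
  -- ≥ 1` serves the contraction factor `1 - c⁻¹` used later.
  refine ⟨max C 1, le_max_right _ _, fun x => ?_⟩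
  rcases eq_or_ne x 0 with rfl | hx
  · simp [qf]
  · have hx' : ‖x‖ ≠ 0 := norm_ne_zero_iff.2 hx
    have hs : ‖x‖⁻¹ • x ∈ Metric.sphere (0 : ι → ℝ) 1 := by simp [norm_smul, hx']
    have h := (hC (Set.mem_image_of_mem _ hs)).trans (le_max_left C 1)
    simp only [qf_smul_vec] at h
    rw [mul_div_mul_left _ _ (pow_ne_zero 2 (inv_ne_zero hx')), div_le_iff₀ (hpos x hx)] at h
    exact h

theorem qf_fromBlocks (A : Matrix ι ι ℝ) (C : Matrix κ ι ℝ) (D : Matrix κ κ ℝ)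
    (z : ι ⊕ κ → ℝ) :
    qf (Matrix.fromBlocks A Cᵀ C D) z
      = qf A (z ∘ Sum.inl) + 2 * ((z ∘ Sum.inr) ⬝ᵥ (C *ᵥ (z ∘ Sum.inl)))
        + qf D (z ∘ Sum.inr) := by
  have h : (z ∘ Sum.inl) ⬝ᵥ (Cᵀ *ᵥ (z ∘ Sum.inr)) = (z ∘ Sum.inr) ⬝ᵥ (C *ᵥ (z ∘ Sum.inl)) := by
    rw [Matrix.mulVec_transpose, dotProduct_comm, Matrix.dotProduct_mulVec]
  have h2 : ∀ (v : ι ⊕ κ → ℝ), z ⬝ᵥ v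
      = (z ∘ Sum.inl) ⬝ᵥ (v ∘ Sum.inl) + (z ∘ Sum.inr) ⬝ᵥ (v ∘ Sum.inr) := by
    intro v; simp [dotProduct, Fintype.sum_sum_type]
  rw [qf, Matrix.fromBlocks_mulVec, h2]
  simp only [Sum.elim_comp_inl, Sum.elim_comp_inr, dotProduct_add, h, qf]
  ring

theorem qf_add_mulVec {σ : Type*} [Fintype σ] {T : Matrix ι ι ℝ} (hT : T.IsHermitian)
    (a : Matrix ι κ ℝ) (b : Matrix ι σ ℝ) (x : κ → ℝ) (u : σ → ℝ) :
    qf T (a *ᵥ x + b *ᵥ u)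
      = qf (aᵀ * T * a) x + 2 * (u ⬝ᵥ ((bᵀ * T * a) *ᵥ x)) + qf (bᵀ * T * b) u := by
  rw [qf_add_vec hT, qf_conj, qf_conj]
  simp only [← Matrix.mulVec_mulVec, Matrix.dotProduct_mulVec u, Matrix.vecMul_transpose]

/-- Completion of the square. -/
theorem complete_square [DecidableEq κ] {σ : Type*} [Fintype σ] {D : Matrix κ κ ℝ} (hD : D.PosDef)
    (h : Matrix κ σ ℝ) (x : σ → ℝ) (u : κ → ℝ) :
    2 * (u ⬝ᵥ (h *ᵥ x)) + qf D u
      = qf D (u - (-(D⁻¹ * h)) *ᵥ x) - qf (hᵀ * D⁻¹ * h) x := by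
  have hu : IsUnit D.det := (Matrix.isUnit_iff_isUnit_det _).1 hD.isUnit
  have h1 : u - (-(D⁻¹ * h)) *ᵥ x = (D⁻¹ * h) *ᵥ x + u := by
    rw [Matrix.neg_mulVec, sub_neg_eq_add, add_comm]
  have h2 : D *ᵥ ((D⁻¹ * h) *ᵥ x) = h *ᵥ x := by
    rw [Matrix.mulVec_mulVec, Matrix.mul_nonsing_inv_cancel_left _ _ hu]
  have h3 : qf D ((D⁻¹ * h) *ᵥ x) = qf (hᵀ * D⁻¹ * h) x := by
    rw [qf_conj, qf, qf, h2, dotProduct_comm, Matrix.mulVec_mulVec]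
  rw [h1, qf_add_vec hD.isHermitian, h2, h3]
  ring

end QuadraticForms

/-! ### Second moments of the noise and the matrix `Σ₀ ⊗ P`. -/

section Moments

variable {d : ℕ} {ν : Measure (Fin d → ℝ)}

/-- The extended noise vector `(1, v)`. -/
def extNoise (v : Fin d → ℝ) : Unit ⊕ Fin d → ℝ := Sum.elim (fun _ => 1) v

theorem memLp_extNoise [IsProbabilityMeasure ν] (hν : MemLp id 2 ν) (i : Unit ⊕ Fin d) :
    MemLp (fun v => extNoise v i) 2 ν := by
  rcases i with i | i
  · exact memLp_const 1
  · exact (ContinuousLinearMap.proj (R := ℝ) (φ := fun _ : Fin d => ℝ) i).comp_memLp' hν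

theorem integrable_extNoise_mul [IsProbabilityMeasure ν] (hν : MemLp id 2 ν) (i j : Unit ⊕ Fin d) :
    Integrable (fun v => extNoise v i * extNoise v j) ν :=
  (memLp_extNoise hν i).integrable_mul (memLp_extNoise hν j)

theorem extCovar_apply [IsProbabilityMeasure ν] (hν : MemLp id 2 ν) (i j : Unit ⊕ Fin d) :
    extCovar ν i j = ∫ v, extNoise v i * extNoise v j ∂ν := by
  rcases i with i | i <;> rcases j with j | j
  · simp [extCovar, extNoise]
  · simp [extCovar, extNoise, mean]
  · simp [extCovar, extNoise, mean]
  · have hc : covar ν i j = ∫ v, v i * v j ∂ν - mean ν i * mean ν j :=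
      covariance_eq_sub (memLp_extNoise hν (Sum.inr i)) (memLp_extNoise hν (Sum.inr j))
    simp [extCovar, extNoise, Matrix.vecMulVec_apply, hc]

/-- The combination `∑ i, zᵢ ξᵢ` of the blocks of `ξ` with the entries of `z = (1, v)`. -/
def blockSum {κ : Type*} (ξ : (Unit ⊕ Fin d) × κ → ℝ) (v : Fin d → ℝ) : κ → ℝ :=
  fun a => ∑ i, extNoise v i * ξ (i, a)

variable {κ : Type*} [Fintype κ]

theorem qf_blockSum (P : Matrix κ κ ℝ) (ξ : (Unit ⊕ Fin d) × κ → ℝ) (v : Fin d → ℝ) :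
    qf P (blockSum ξ v)
      = ∑ p, ∑ q, extNoise v p.1 * extNoise v q.1 * (ξ p * P p.2 q.2 * ξ q) := by
  simp only [qf, blockSum, dotProduct, Matrix.mulVec, Fintype.sum_prod_type_right, Finset.mul_sum,
    Finset.sum_mul]
  refine Finset.sum_congr rfl fun a _ => ?_
  conv_rhs => rw [Finset.sum_comm]
  refine Finset.sum_congr rfl fun b _ => ?_
  conv_rhs => rw [Finset.sum_comm]
  exact Finset.sum_congr rfl fun j _ => Finset.sum_congr rfl fun i _ => by ring

theorem integrable_qf_blockSum [IsProbabilityMeasure ν] (hν : MemLp id 2 ν) (P : Matrix κ κ ℝ)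
    (ξ : (Unit ⊕ Fin d) × κ → ℝ) : Integrable (fun v => qf P (blockSum ξ v)) ν := by
  simp only [qf_blockSum]
  exact integrable_finsetSum _ fun p _ => integrable_finsetSum _ fun q _ =>
    (integrable_extNoise_mul hν _ _).mul_const _

/-- After expansion over pairs of blocks, the noise enters only through the products `zᵢ zⱼ`, whose
means are the entries of `Σ₀`. -/
theorem integral_qf_blockSum [IsProbabilityMeasure ν] (hν : MemLp id 2 ν) (P : Matrix κ κ ℝ)
    (ξ : (Unit ⊕ Fin d) × κ → ℝ) :
    ∫ v, qf P (blockSum ξ v) ∂ν = qf (extCovar ν ⊗ₖ P) ξ := by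
  simp only [qf_blockSum]
  rw [integral_finsetSum _ fun p _ => integrable_finsetSum _ fun q _ =>
    (integrable_extNoise_mul hν _ _).mul_const _]
  simp only [qf, dotProduct, Matrix.mulVec, Finset.mul_sum]
  refine Finset.sum_congr rfl fun p _ => ?_
  rw [integral_finsetSum _ fun q _ => (integrable_extNoise_mul hν _ _).mul_const _]
  refine Finset.sum_congr rfl fun q _ => ?_
  rw [integral_mul_const, ← extCovar_apply hν, Matrix.kroneckerMap_apply]
  ring

theorem extCovar_isHermitian [IsProbabilityMeasure ν] (hν : MemLp id 2 ν) :
    (extCovar ν).IsHermitian := by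
  ext i j
  simp only [Matrix.conjTranspose_apply, star_trivial, extCovar_apply hν, mul_comm]

theorem kronecker_isHermitian {κ : Type*} [IsProbabilityMeasure ν] (hν : MemLp id 2 ν)
    {P : Matrix κ κ ℝ}
    (hP : P.IsHermitian) : (extCovar ν ⊗ₖ P).IsHermitian := by
  rw [Matrix.IsHermitian, Matrix.conjTranspose_kronecker, (extCovar_isHermitian hν).eq, hP.eq]

/-- The form is a mean of values of the form of `P`, so positivity is inherited with no
factorization of `Σ₀`. -/
theorem kronecker_posSemidef [IsProbabilityMeasure ν] (hν : MemLp id 2 ν) {P : Matrix κ κ ℝ}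
    (hP : P.PosSemidef) : (extCovar ν ⊗ₖ P).PosSemidef := by
  refine posSemidef_iff_qf.2 ⟨kronecker_isHermitian hν hP.isHermitian, fun ξ => ?_⟩
  rw [← integral_qf_blockSum hν]
  exact integral_nonneg fun v => qf_nonneg hP _

theorem lintegral_qf_blockSum [IsProbabilityMeasure ν] (hν : MemLp id 2 ν) {P : Matrix κ κ ℝ}
    (hP : P.PosSemidef) (ξ : (Unit ⊕ Fin d) × κ → ℝ) :
    ∫⁻ v, ENNReal.ofReal (qf P (blockSum ξ v)) ∂ν
      = ENNReal.ofReal (qf (extCovar ν ⊗ₖ P) ξ) := by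
  rw [← integral_qf_blockSum hν, ofReal_integral_eq_lintegral_ofReal
    (integrable_qf_blockSum hν P ξ) (Eventually.of_forall fun v => qf_nonneg hP _)]

theorem kronecker_mono [IsProbabilityMeasure ν] (hν : MemLp id 2 ν) {P P' : Matrix κ κ ℝ}
    (h : (P' - P).PosSemidef) (ξ : (Unit ⊕ Fin d) × κ → ℝ) :
    qf (extCovar ν ⊗ₖ P) ξ ≤ qf (extCovar ν ⊗ₖ P') ξ := by
  have h1 := qf_nonneg (kronecker_posSemidef hν h) ξ
  have h2 : extCovar ν ⊗ₖ P' = extCovar ν ⊗ₖ P + extCovar ν ⊗ₖ (P' - P) := by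
    rw [← Matrix.kronecker_add, add_sub_cancel]
  rw [h2, qf_add]
  linarith

theorem blockSum_stack {n m : ℕ} (M₀ : Matrix (Fin n) (Fin m) ℝ)
    (M : Fin d → Matrix (Fin n) (Fin m) ℝ) (x : Fin m → ℝ) (v : Fin d → ℝ) :
    blockSum (stack M₀ M *ᵥ x) v = affine M₀ M v *ᵥ x := by
  ext a
  simp only [blockSum, Fintype.sum_sum_type, extNoise, affine, Matrix.add_mulVec, Pi.add_apply,
    Matrix.sum_mulVec, Finset.sum_apply, Matrix.smul_mulVec, Pi.smul_apply, smul_eq_mul]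
  simp [stack, Matrix.mulVec, dotProduct]

theorem blockSum_add {κ : Type*} (ξ η : (Unit ⊕ Fin d) × κ → ℝ) (v : Fin d → ℝ) :
    blockSum (ξ + η) v = blockSum ξ v + blockSum η v := by
  ext a; simp [blockSum, mul_add, Finset.sum_add_distrib]

end Moments

/-! ### Comparison principle from a Lyapunov matrix. -/

section Comparison

variable {n d : ℕ} {ν : Measure (Fin d → ℝ)} [IsProbabilityMeasure ν]

/-- Comparison principle for the Lyapunov inequality. -/
theorem posSemidef_of_lyapunov (hν : MemLp id 2 ν) {M₀ : Matrix (Fin n) (Fin n) ℝ}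
    {M : Fin d → Matrix (Fin n) (Fin n) ℝ} {L : Matrix (Fin n) (Fin n) ℝ}
    (hL : Lyapunov ν M₀ M L) {D : Matrix (Fin n) (Fin n) ℝ} (hD : D.IsHermitian)
    (h : ∀ x, qf (extCovar ν ⊗ₖ D) (stack M₀ M *ᵥ x) ≤ qf D x) : D.PosSemidef := by
  obtain ⟨hL1, hL2⟩ := hL
  obtain ⟨c, hc1, hc⟩ := exists_qf_le hL2 L
  obtain ⟨s, hs1, hs⟩ := exists_qf_le hL1 (-D)
  -- `L` is at most `c` times its one-step decrease, so a step contracts `L` by the factor `1 -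
  -- c⁻¹`; `1 ≤ c` makes this factor nonnegative.
  have hr0 : 0 ≤ 1 - c⁻¹ := sub_nonneg.2 (inv_le_one_of_one_le₀ hc1)
  have hr1 : 1 - c⁻¹ < 1 := by have : 0 < c⁻¹ := by positivity
                               linarith
  set r := 1 - c⁻¹ with hr
  have hLr : ∀ x, qf (extCovar ν ⊗ₖ L) (stack M₀ M *ᵥ x) ≤ r * qf L x := by
    intro x
    have h1 := hc x
    rw [qf_sub, qf_conj] at h1
    have h2 : c⁻¹ * qf L x ≤ qf L x - qf (extCovar ν ⊗ₖ L) (stack M₀ M *ᵥ x) := by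
      rw [inv_mul_le_iff₀ (by positivity)]; exact h1
    rw [hr]; linarith
  -- The negative part of `D` is dominated by `s • L`. Each use of `h` pushes the bound through one
  -- step of the dynamics and gains a factor `r`; in the limit nothing is left.
  have key : ∀ k : ℕ, (D + (s * r ^ k) • L).PosSemidef := by
    intro k
    refine posSemidef_iff_qf.2 ⟨hD.add (by
      rw [Matrix.IsHermitian, Matrix.conjTranspose_smul, hL1.isHermitian.eq, star_trivial]), ?_⟩
    induction k with
    | zero =>
      intro x
      have h1 := hs x
      have h2 : qf (-D) x = - qf D x := by simp [qf, Matrix.neg_mulVec]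
      rw [qf_add, qf_smul]
      linarith
    | succ k ih =>
      intro x
      have h1 : (D + (s * r ^ k) • L).PosSemidef := posSemidef_iff_qf.2 ⟨hD.add (by
        rw [Matrix.IsHermitian, Matrix.conjTranspose_smul, hL1.isHermitian.eq, star_trivial]), ih⟩
      have h2 := qf_nonneg (kronecker_posSemidef hν h1) (stack M₀ M *ᵥ x)
      rw [Matrix.kronecker_add, Matrix.kronecker_smul, qf_add, qf_smul] at h2
      have h3 : 0 ≤ s * r ^ k := by positivity
      have h4 := mul_le_mul_of_nonneg_left (hLr x) h3
      have h5 := h x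
      rw [qf_add, qf_smul, pow_succ]
      nlinarith
  refine posSemidef_iff_qf.2 ⟨hD, fun x => ?_⟩
  have hlim : Tendsto (fun k : ℕ => qf D x + s * r ^ k * qf L x) atTop
      (𝓝 (qf D x + s * 0 * qf L x)) :=
    (((tendsto_pow_atTop_nhds_zero_of_lt_one hr0 hr1).const_mul s).mul_const _).const_add _
  have hk : ∀ k : ℕ, 0 ≤ qf D x + s * r ^ k * qf L x := fun k => by
    rw [← qf_smul, ← qf_add]
    exact qf_nonneg (key k) x
  simpa using ge_of_tendsto' hlim hk

end Comparison

/-! ### The Bellman operator, the semidefinite program and existence for the Riccati equation. -/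

section RiccatiEquation

variable {n m d : ℕ} {ν : Measure (Fin d → ℝ)}
  {S : Sys n m d} {Q : Matrix (Fin n) (Fin n) ℝ} {R : Matrix (Fin m) (Fin m) ℝ}
  {P P' : Matrix (Fin n) (Fin n) ℝ}

/-- The one-step cost from the state `x` under the input `u` with terminal cost `yᵀ P y`. -/
noncomputable def oneStep (S : Sys n m d) (ν : Measure (Fin d → ℝ))
    (Q : Matrix (Fin n) (Fin n) ℝ) (R : Matrix (Fin m) (Fin m) ℝ)
    (P : Matrix (Fin n) (Fin n) ℝ) (x : Fin n → ℝ) (u : Fin m → ℝ) : ℝ :=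
  qf Q x + qf R u + qf (extCovar ν ⊗ₖ P) (stack S.A₀ S.A *ᵥ x + stack S.B₀ S.B *ᵥ u)

/-- The right-hand side of the Riccati equation. -/
noncomputable def riccatiMap (S : Sys n m d) (ν : Measure (Fin d → ℝ))
    (Q : Matrix (Fin n) (Fin n) ℝ) (R : Matrix (Fin m) (Fin m) ℝ)
    (P : Matrix (Fin n) (Fin n) ℝ) : Matrix (Fin n) (Fin n) ℝ :=
  Q + F S ν P - (H S ν P)ᵀ * (R + G S ν P)⁻¹ * H S ν P

theorem isHermitian_congr {ι κ : Type*} [Fintype ι] {T : Matrix ι ι ℝ} (hT : T.IsHermitian)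
    (a : Matrix ι κ ℝ) : (aᵀ * T * a).IsHermitian := by
  rw [← Matrix.conjTranspose_eq_transpose_of_trivial]
  exact Matrix.isHermitian_conjTranspose_mul_mul a hT

theorem posDef_add_G [IsProbabilityMeasure ν] (hν : MemLp id 2 ν) (hR : R.PosDef)
    (hP : P.PosSemidef) : (R + G S ν P).PosDef := by
  refine hR.add_posSemidef ?_
  rw [G, ← Matrix.conjTranspose_eq_transpose_of_trivial]
  exact (kronecker_posSemidef hν hP).conjTranspose_mul_mul_same _

theorem riccatiMap_isHermitian [IsProbabilityMeasure ν] (hν : MemLp id 2 ν) (hQ : Q.IsHermitian)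
    (hR : R.PosDef) (hP : P.PosSemidef) : (riccatiMap S ν Q R P).IsHermitian :=
  (hQ.add (isHermitian_congr (kronecker_isHermitian hν hP.isHermitian) _)).sub
    (isHermitian_congr (posDef_add_G hν hR hP).isHermitian.inv _)

theorem oneStep_eq_blocks [IsProbabilityMeasure ν] (hν : MemLp id 2 ν) (hP : P.IsHermitian)
    (x : Fin n → ℝ) (u : Fin m → ℝ) :
    oneStep S ν Q R P x u
      = qf (Q + F S ν P) x + 2 * (u ⬝ᵥ (H S ν P *ᵥ x)) + qf (R + G S ν P) u := by
  rw [oneStep, qf_add_mulVec (kronecker_isHermitian hν hP), qf_add, qf_add, F, G, H]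
  ring

/-- The one-step cost is minimized by the feedback with gain `gain S ν R P`, and its minimum is
the quadratic form of `riccatiMap S ν Q R P`. -/
theorem oneStep_eq [IsProbabilityMeasure ν] (hν : MemLp id 2 ν) (hR : R.PosDef)
    (hP : P.PosSemidef) (x : Fin n → ℝ) (u : Fin m → ℝ) :
    oneStep S ν Q R P x u = qf (riccatiMap S ν Q R P) x
      + qf (R + G S ν P) (u - gain S ν R P *ᵥ x) := by
  rw [oneStep_eq_blocks hν hP.isHermitian, riccatiMap, qf_sub, gain, add_assoc,
    complete_square (posDef_add_G hν hR hP)]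
  ring

theorem qf_riccatiMap_le_oneStep [IsProbabilityMeasure ν] (hν : MemLp id 2 ν) (hR : R.PosDef)
    (hP : P.PosSemidef) (x : Fin n → ℝ) (u : Fin m → ℝ) :
    qf (riccatiMap S ν Q R P) x ≤ oneStep S ν Q R P x u := by
  rw [oneStep_eq hν hR hP]
  exact le_add_of_nonneg_right (qf_nonneg (posDef_add_G hν hR hP).posSemidef _)

theorem oneStep_gain [IsProbabilityMeasure ν] (hν : MemLp id 2 ν) (hR : R.PosDef)
    (hP : P.PosSemidef) (x : Fin n → ℝ) :
    oneStep S ν Q R P x (gain S ν R P *ᵥ x) = qf (riccatiMap S ν Q R P) x := by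
  rw [oneStep_eq hν hR hP, sub_self]
  simp [qf]

theorem oneStep_mono [IsProbabilityMeasure ν] (hν : MemLp id 2 ν) (h : (P' - P).PosSemidef)
    (x : Fin n → ℝ) (u : Fin m → ℝ) : oneStep S ν Q R P x u ≤ oneStep S ν Q R P' x u :=
  add_le_add_right (kronecker_mono hν h _) _

/-- The form of the block matrix at `(x, u)` is exactly the one-step cost minus `qf P x`, so no
Schur complement is needed. -/
theorem mem_sdpFeasible_iff [IsProbabilityMeasure ν] (hν : MemLp id 2 ν) (hQ : Q.IsHermitian)
    (hR : R.IsHermitian) : P ∈ sdpFeasible S ν Q R ↔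
      P.PosSemidef ∧ ∀ x u, qf P x ≤ oneStep S ν Q R P x u := by
  rw [sdpFeasible, Set.mem_ofPred_eq, and_comm]
  refine and_congr_right fun hP => ?_
  have hT := kronecker_isHermitian hν hP.isHermitian
  have hherm : (Matrix.fromBlocks (Q - P + F S ν P) (H S ν P)ᵀ (H S ν P)
      (R + G S ν P)).IsHermitian :=
    Matrix.IsHermitian.fromBlocks ((hQ.sub hP.isHermitian).add (isHermitian_congr hT _))
      (by ext; simp) (hR.add (isHermitian_congr hT _))
  have hval : ∀ z : Fin n ⊕ Fin m → ℝ, qf (Matrix.fromBlocks (Q - P + F S ν P) (H S ν P)ᵀ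
      (H S ν P) (R + G S ν P)) z
        = oneStep S ν Q R P (z ∘ Sum.inl) (z ∘ Sum.inr) - qf P (z ∘ Sum.inl) := by
    intro z
    rw [qf_fromBlocks, oneStep_eq_blocks hν hP.isHermitian, qf_add, qf_sub, qf_add Q]
    ring
  rw [posSemidef_iff_qf, and_iff_right hherm]
  constructor
  · intro h x u
    have := h (Sum.elim x u)
    rw [hval, Sum.elim_comp_inl, Sum.elim_comp_inr] at this
    linarith
  · intro h z
    rw [hval]
    linarith [h (z ∘ Sum.inl) (z ∘ Sum.inr)]

theorem stack_cl_mulVec (S : Sys n m d) (K : Matrix (Fin m) (Fin n) ℝ) (x : Fin n → ℝ) :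
    stack (S.cl₀ K) (S.cl K) *ᵥ x
      = stack S.A₀ S.A *ᵥ x + stack S.B₀ S.B *ᵥ (K *ᵥ x) := by
  have h : stack (S.cl₀ K) (S.cl K) = stack S.A₀ S.A + stack S.B₀ S.B * K := by
    ext ⟨i, a⟩ j
    rcases i with i | i <;> simp [stack, Sys.cl₀, Sys.cl, Matrix.mul_apply]
  rw [h, Matrix.add_mulVec, Matrix.mulVec_mulVec]

theorem oneStep_feedback (K : Matrix (Fin m) (Fin n) ℝ) (x : Fin n → ℝ) :
    oneStep S ν Q R P x (K *ᵥ x) = qf (Q + Kᵀ * R * K) x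
      + qf (extCovar ν ⊗ₖ P) (stack (S.cl₀ K) (S.cl K) *ᵥ x) := by
  rw [oneStep, stack_cl_mulVec, qf_add, qf_conj]

/-- A supersolution for a stabilizing gain dominates every subsolution. -/
theorem posSemidef_sub_of_lyapunov [IsProbabilityMeasure ν] (hν : MemLp id 2 ν)
    {K : Matrix (Fin m) (Fin n) ℝ} {L : Matrix (Fin n) (Fin n) ℝ}
    (hL : Lyapunov ν (S.cl₀ K) (S.cl K) L) (hP : P.IsHermitian) (hP' : P'.IsHermitian)
    (hsub : ∀ x u, qf P x ≤ oneStep S ν Q R P x u)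
    (hsup : ∀ x, oneStep S ν Q R P' x (K *ᵥ x) ≤ qf P' x) : (P' - P).PosSemidef := by
  refine posSemidef_of_lyapunov hν hL (hP'.sub hP) fun x => ?_
  have h1 := hsub x (K *ᵥ x)
  have h2 := hsup x
  have h3 : extCovar ν ⊗ₖ P' = extCovar ν ⊗ₖ P + extCovar ν ⊗ₖ (P' - P) := by
    rw [← Matrix.kronecker_add, add_sub_cancel]
  rw [oneStep_feedback] at h1 h2
  rw [h3, qf_add (extCovar ν ⊗ₖ P)] at h2
  rw [qf_sub]
  linarith

/-- A large multiple `c • L` of the Lyapunov matrix is a supersolution for the stabilizing gain: its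
decrease absorbs the stage cost `Q + Kᵀ R K`. -/
theorem exists_upper_bound [IsProbabilityMeasure ν] (hν : MemLp id 2 ν) (hQ : Q.IsHermitian)
    (hR : R.IsHermitian) (hS : Stabilizable S ν) :
    ∃ U : Matrix (Fin n) (Fin n) ℝ, ∀ P ∈ sdpFeasible S ν Q R, (U - P).PosSemidef := by
  obtain ⟨K, L, hL⟩ := hS
  obtain ⟨c, -, hc⟩ := exists_qf_le hL.2 (Q + Kᵀ * R * K)
  refine ⟨c • L, fun P hP => ?_⟩
  obtain ⟨hP1, hP2⟩ := (mem_sdpFeasible_iff hν hQ hR).1 hP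
  refine posSemidef_sub_of_lyapunov (S := S) (Q := Q) (R := R) hν hL hP1.isHermitian ?_ hP2
    fun x => ?_
  · rw [Matrix.IsHermitian, Matrix.conjTranspose_smul, hL.1.isHermitian.eq, star_trivial]
  · have := hc x
    rw [qf_sub, qf_conj] at this
    rw [oneStep_feedback, Matrix.kronecker_smul, qf_smul, qf_smul]
    linarith

/-- Testing on `eᵢ ± eⱼ` gives `2 |M i j| ≤ M i i + M j j`, and each diagonal entry is at most the
trace. -/
theorem abs_apply_le_trace {ι : Type*} [Fintype ι] [DecidableEq ι] {M : Matrix ι ι ℝ}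
    (hM : M.PosSemidef) (i j : ι) : |M i j| ≤ M.trace := by
  have hle : ∀ i, M i i ≤ M.trace := fun i =>
    Finset.single_le_sum (f := fun i => M i i) (fun i _ => hM.diag_nonneg) (Finset.mem_univ i)
  have hsym : M j i = M i j := by simpa using hM.isHermitian.apply i j
  have h1 := qf_nonneg hM (Pi.single i 1 + Pi.single j 1)
  have h2 := qf_nonneg hM (Pi.single i 1 - Pi.single j 1)
  simp only [qf, Matrix.mulVec_add, Matrix.mulVec_sub, dotProduct_add, add_dotProduct,
    dotProduct_sub, sub_dotProduct, Matrix.mulVec_single_one, single_one_dotProduct,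
    Matrix.col_apply, hsym] at h1 h2
  have := hle i
  have := hle j
  rw [abs_le]
  constructor <;> linarith

theorem continuous_qf_kronecker {σ ι : Type*} [Fintype σ] [Fintype ι] (C : Matrix σ σ ℝ)
    (ξ : σ × ι → ℝ) : Continuous fun P : Matrix ι ι ℝ => qf (C ⊗ₖ P) ξ := by
  have h : Continuous fun P : Matrix ι ι ℝ => C ⊗ₖ P :=
    continuous_matrix fun p q => by
      simp only [Matrix.kroneckerMap_apply]
      exact continuous_const.mul (continuous_id.matrix_elem _ _)
  unfold qf
  fun_prop

theorem isCompact_sdpFeasible [IsProbabilityMeasure ν] (hν : MemLp id 2 ν) (hQ : Q.IsHermitian)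
    (hR : R.IsHermitian) (hS : Stabilizable S ν) : IsCompact (sdpFeasible S ν Q R) := by
  obtain ⟨U, hU⟩ := exists_upper_bound hν hQ hR hS
  have hbox : IsCompact (Set.pi Set.univ fun _ : Fin n => Set.pi Set.univ fun _ : Fin n =>
      Set.Icc (-U.trace) U.trace) :=
    isCompact_univ_pi fun _ => isCompact_univ_pi fun _ => isCompact_Icc
  have hclosed : IsClosed (sdpFeasible S ν Q R) := by
    -- For fixed `x` and `u` each condition is closed in `P`, by continuity of both sides.
    have heq : sdpFeasible S ν Q R = {P | Pᴴ = P} ∩ (⋂ x, {P | 0 ≤ qf P x}) ∩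
        ⋂ x, ⋂ u, {P | qf P x ≤ oneStep S ν Q R P x u} := by
      ext P
      simp only [mem_sdpFeasible_iff hν hQ hR, posSemidef_iff_qf, Set.mem_inter_iff,
        Set.mem_iInter, Set.mem_ofPred_eq, Matrix.IsHermitian]
    have hq : ∀ x, Continuous fun P : Matrix (Fin n) (Fin n) ℝ => qf P x := fun x => by
      unfold qf; fun_prop
    rw [heq]
    refine ((isClosed_eq (by fun_prop) continuous_id).inter (isClosed_iInter fun x =>
      isClosed_le continuous_const (hq x))).inter
      (isClosed_iInter fun x => isClosed_iInter fun u => isClosed_le (hq x) ?_)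
    exact (continuous_qf_kronecker _ _).const_add _
  refine hbox.of_isClosed_subset hclosed fun (P : Matrix (Fin n) (Fin n) ℝ) hP => ?_
  refine fun i _ j _ => abs_le.1 ?_
  refine (abs_apply_le_trace hP.2 i j).trans ?_
  have := (hU P hP).trace_nonneg
  rw [Matrix.trace_sub] at this
  linarith

theorem zero_mem_sdpFeasible [IsProbabilityMeasure ν] (hν : MemLp id 2 ν) (hQ : Q.PosSemidef)
    (hR : R.PosSemidef) : (0 : Matrix (Fin n) (Fin n) ℝ) ∈ sdpFeasible S ν Q R := by
  refine (mem_sdpFeasible_iff hν hQ.isHermitian hR.isHermitian).2 ⟨.zero, fun x u => ?_⟩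
  have h1 := qf_nonneg hQ x
  have h2 := qf_nonneg hR u
  have h3 := qf_nonneg (kronecker_posSemidef hν (.zero (n := Fin n)))
    (stack S.A₀ S.A *ᵥ x + stack S.B₀ S.B *ᵥ u)
  have h4 : qf (0 : Matrix (Fin n) (Fin n) ℝ) x = 0 := by simp [qf]
  rw [oneStep, h4]
  positivity

theorem sub_riccatiMap_posSemidef [IsProbabilityMeasure ν] (hν : MemLp id 2 ν) (hQ : Q.PosDef)
    (hR : R.PosDef) (hP : P ∈ sdpFeasible S ν Q R) : (riccatiMap S ν Q R P - P).PosSemidef := by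
  obtain ⟨hP1, hP2⟩ := (mem_sdpFeasible_iff hν hQ.isHermitian hR.isHermitian).1 hP
  refine posSemidef_iff_qf.2
    ⟨(riccatiMap_isHermitian hν hQ.isHermitian hR hP1).sub hP1.isHermitian, fun x => ?_⟩
  rw [qf_sub, ← oneStep_gain hν hR hP1]
  linarith [hP2 x (gain S ν R P *ᵥ x)]

/-- `riccatiMap` of `P` lies below the one-step cost for `P`, which lies below the one-step cost for
the larger matrix. -/
theorem riccatiMap_mem_sdpFeasible [IsProbabilityMeasure ν] (hν : MemLp id 2 ν) (hQ : Q.PosDef)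
    (hR : R.PosDef) (hP : P ∈ sdpFeasible S ν Q R) :
    riccatiMap S ν Q R P ∈ sdpFeasible S ν Q R := by
  have h := sub_riccatiMap_posSemidef hν hQ hR hP
  refine (mem_sdpFeasible_iff hν hQ.isHermitian hR.isHermitian).2
    ⟨by simpa using h.add hP.2, fun x u => ?_⟩
  exact (qf_riccatiMap_le_oneStep hν hR hP.2 x u).trans (oneStep_mono hν h x u)

theorem eq_of_posSemidef_sub_of_trace_le {ι : Type*} [Fintype ι] {M N : Matrix ι ι ℝ}
    (h : (M - N).PosSemidef) (ht : M.trace ≤ N.trace) : N = M := by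
  have h0 : (M - N).trace = 0 :=
    le_antisymm (by rw [Matrix.trace_sub]; linarith) h.trace_nonneg
  exact (sub_eq_zero.1 (h.trace_eq_zero_iff.1 h0)).symm

/-- At a trace maximizer `P`, the image under `riccatiMap` is feasible and dominates `P`, yet cannot
have larger trace; the difference is positive semidefinite with zero trace, hence zero. -/
theorem exists_riccati [IsProbabilityMeasure ν] (hν : MemLp id 2 ν) (hQ : Q.PosDef)
    (hR : R.PosDef) (hS : Stabilizable S ν) :
    ∃ P : Matrix (Fin n) (Fin n) ℝ, P.PosSemidef ∧ Riccati S ν Q R P := by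
  obtain ⟨P, hP, hmax⟩ := (isCompact_sdpFeasible hν hQ.isHermitian hR.isHermitian hS
    (Q := Q) (R := R)).exists_isMaxOn ⟨0, zero_mem_sdpFeasible hν hQ.posSemidef hR.posSemidef⟩
    (f := Matrix.trace) (by fun_prop)
  refine ⟨P, hP.2, ?_⟩
  exact eq_of_posSemidef_sub_of_trace_le (sub_riccatiMap_posSemidef hν hQ hR hP)
    (hmax (riccatiMap_mem_sdpFeasible hν hQ hR hP))

/-! ### Stability, maximality and uniqueness of Riccati solutions. -/

theorem Riccati.oneStep_gain [IsProbabilityMeasure ν] (hν : MemLp id 2 ν) (hR : R.PosDef)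
    (hP : P.PosSemidef) (h : Riccati S ν Q R P) (x : Fin n → ℝ) :
    oneStep S ν Q R P x (gain S ν R P *ᵥ x) = qf P x := by
  rw [MultNoise.oneStep_gain hν hR hP, riccatiMap, ← h]

theorem Riccati.oneStep_eq [IsProbabilityMeasure ν] (hν : MemLp id 2 ν) (hR : R.PosDef)
    (hP : P.PosSemidef) (h : Riccati S ν Q R P) (x : Fin n → ℝ) (u : Fin m → ℝ) :
    oneStep S ν Q R P x u = qf P x + qf (R + G S ν P) (u - gain S ν R P *ᵥ x) := by
  rw [MultNoise.oneStep_eq hν hR hP, riccatiMap, ← h]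

theorem Riccati.mem_sdpFeasible [IsProbabilityMeasure ν] (hν : MemLp id 2 ν) (hQ : Q.PosDef)
    (hR : R.PosDef) (hP : P.PosSemidef) (h : Riccati S ν Q R P) : P ∈ sdpFeasible S ν Q R := by
  refine (mem_sdpFeasible_iff hν hQ.isHermitian hR.isHermitian).2 ⟨hP, fun x u => ?_⟩
  rw [h.oneStep_eq hν hR hP]
  exact le_add_of_nonneg_right (qf_nonneg (posDef_add_G hν hR hP).posSemidef _)

/-- A positive semidefinite solution of the Riccati equation is a Lyapunov matrix for its own
gain. -/
theorem Riccati.lyapunov [IsProbabilityMeasure ν] (hν : MemLp id 2 ν) (hQ : Q.PosDef)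
    (hR : R.PosDef) (hP : P.PosSemidef) (h : Riccati S ν Q R P) :
    Lyapunov ν (S.cl₀ (gain S ν R P)) (S.cl (gain S ν R P)) P := by
  -- Along its own gain `K`, the closed-loop decrease of `P` is exactly `Q + Kᵀ R K`, which is
  -- positive definite because `Q` is.
  have hval : ∀ x, qf P x = qf Q x + qf R (gain S ν R P *ᵥ x)
      + qf (extCovar ν ⊗ₖ P) (stack (S.cl₀ (gain S ν R P)) (S.cl (gain S ν R P)) *ᵥ x) :=
    fun x => by rw [← h.oneStep_gain hν hR hP, oneStep_feedback, qf_add, qf_conj]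
  have hQx := (posDef_iff_qf.1 hQ).2
  refine ⟨posDef_iff_qf.2 ⟨hP.isHermitian, fun x hx => ?_⟩, posDef_iff_qf.2
    ⟨hP.isHermitian.sub (isHermitian_congr (kronecker_isHermitian hν hP.isHermitian) _),
      fun x hx => ?_⟩⟩
  · rw [hval]
    have := hQx x hx
    have := qf_nonneg hR.posSemidef (gain S ν R P *ᵥ x)
    have := qf_nonneg (kronecker_posSemidef hν hP)
      (stack (S.cl₀ (gain S ν R P)) (S.cl (gain S ν R P)) *ᵥ x)
    linarith
  · rw [qf_sub, qf_conj, hval]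
    have := hQx x hx
    have := qf_nonneg hR.posSemidef (gain S ν R P *ᵥ x)
    linarith

/-- A positive semidefinite solution of the Riccati equation dominates the feasible set. -/
theorem Riccati.isMax [IsProbabilityMeasure ν] (hν : MemLp id 2 ν) (hQ : Q.PosDef)
    (hR : R.PosDef) (hP : P.PosSemidef) (h : Riccati S ν Q R P)
    (hP' : P' ∈ sdpFeasible S ν Q R) : (P - P').PosSemidef :=
  posSemidef_sub_of_lyapunov hν (h.lyapunov hν hQ hR hP) hP'.2.isHermitian hP.isHermitian
    ((mem_sdpFeasible_iff hν hQ.isHermitian hR.isHermitian).1 hP').2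
    fun x => (h.oneStep_gain hν hR hP x).le

/-- Both solutions are feasible, so each dominates the other. -/
theorem Riccati.unique [IsProbabilityMeasure ν] (hν : MemLp id 2 ν) (hQ : Q.PosDef)
    (hR : R.PosDef) (hP : P.PosSemidef) (h : Riccati S ν Q R P)
    (hP' : P'.PosSemidef) (h' : Riccati S ν Q R P') : P' = P := by
  have h1 := h'.isMax hν hQ hR hP' (h.mem_sdpFeasible hν hQ hR hP)
  refine eq_of_posSemidef_sub_of_trace_le
    (h.isMax hν hQ hR hP (h'.mem_sdpFeasible hν hQ hR hP')) ?_
  have := h1.trace_nonneg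
  rw [Matrix.trace_sub] at this
  linarith

theorem Riccati.isSdpSolution_iff [IsProbabilityMeasure ν] (hν : MemLp id 2 ν) (hQ : Q.PosDef)
    (hR : R.PosDef) (hP : P.PosSemidef) (h : Riccati S ν Q R P) :
    IsSdpSolution S ν Q R P' ↔ P' = P := by
  have hfeas := h.mem_sdpFeasible hν hQ hR hP
  constructor
  · rintro ⟨h1, h2⟩
    exact eq_of_posSemidef_sub_of_trace_le (h.isMax hν hQ hR hP h1) (neg_le_neg_iff.1 (h2 hfeas))
  · rintro rfl
    refine ⟨hfeas, fun N hN => ?_⟩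
    have := (h.isMax hν hQ hR hP hN).trace_nonneg
    rw [Matrix.trace_sub] at this
    simp only [Set.mem_ofPred_eq]
    linarith

end RiccatiEquation

/-! ### Expected cost along admissible inputs. -/

theorem state_succ {n m d : ℕ} {Ω : Type*} (S : Sys n m d) (w : ℕ → Ω → Fin d → ℝ) (x₀ : Fin n → ℝ)
    (u : ℕ → Ω → Fin m → ℝ) (k : ℕ) (ω : Ω) :
    S.state w x₀ u (k + 1) ω
      = blockSum (stack S.A₀ S.A *ᵥ S.state w x₀ u k ω + stack S.B₀ S.B *ᵥ u k ω) (w k ω) := by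
  rw [blockSum_add, blockSum_stack, blockSum_stack, Sys.state]

theorem measurable_qf_comp {ι α : Type*} [Fintype ι] [MeasurableSpace α] {f : α → ι → ℝ}
    (hf : Measurable f) (M : Matrix ι ι ℝ) : Measurable fun a => qf M (f a) :=
  (continuous_qf M).measurable.comp hf

section Cost

variable {n m d : ℕ} {Ω : Type*} [mΩ : MeasurableSpace Ω] {Pr : Measure Ω}
  {ν : Measure (Fin d → ℝ)} {w : ℕ → Ω → Fin d → ℝ}
  {S : Sys n m d} {Q : Matrix (Fin n) (Fin n) ℝ} {R : Matrix (Fin m) (Fin m) ℝ}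
  {P : Matrix (Fin n) (Fin n) ℝ} {x₀ : Fin n → ℝ} {u : ℕ → Ω → Fin m → ℝ}

theorem continuous_drift (S : Sys n m d) :
    Continuous fun p : (Fin n → ℝ) × (Fin m → ℝ) =>
      stack S.A₀ S.A *ᵥ p.1 + stack S.B₀ S.B *ᵥ p.2 := by
  fun_prop

theorem continuous_blockSum {κ : Type*} :
    Continuous fun p : ((Unit ⊕ Fin d) × κ → ℝ) × (Fin d → ℝ) => blockSum p.1 p.2 := by
  refine continuous_pi fun a => ?_
  simp only [blockSum, Fintype.sum_sum_type, extNoise, Sum.elim_inl, Sum.elim_inr]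
  fun_prop

theorem measurable_state {ℱ : Filtration ℕ mΩ} (hw : ∀ k, Measurable[ℱ (k + 1)] (w k))
    (hu : ∀ k, Measurable[ℱ k] (u k)) (k : ℕ) : Measurable[ℱ k] (S.state w x₀ u k) := by
  induction k with
  | zero => exact measurable_const
  | succ k ih =>
    have h1 : Measurable[ℱ (k + 1)] (fun ω => (S.state w x₀ u k ω, u k ω)) :=
      (Measurable.prodMk ih (hu k)).mono (ℱ.mono k.le_succ) le_rfl
    have h2 := (continuous_drift S).measurable.comp h1
    have h3 := continuous_blockSum.measurable.comp (h2.prodMk (hw k))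
    convert! h3 using 1
    ext1 ω
    exact state_succ S w x₀ u k ω

/-- If `ξ` is independent of `v ∼ ν`, the expectation of `(∑ zᵢ ξᵢ)ᵀ P (∑ zᵢ ξᵢ)`, `z = (1, v)`,
is that of `ξᵀ (Σ₀ ⊗ P) ξ`. -/
theorem lintegral_qf_blockSum_of_indep [IsProbabilityMeasure Pr] [IsProbabilityMeasure ν]
    (hν : MemLp id 2 ν) (hP : P.PosSemidef) {ξ : Ω → (Unit ⊕ Fin d) × Fin n → ℝ}
    {v : Ω → Fin d → ℝ} (hξ : Measurable ξ) (hv : Measurable v) (h : IndepFun ξ v Pr)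
    (hlaw : Pr.map v = ν) :
    ∫⁻ ω, ENNReal.ofReal (qf P (blockSum (ξ ω) (v ω))) ∂Pr
      = ∫⁻ ω, ENNReal.ofReal (qf (extCovar ν ⊗ₖ P) (ξ ω)) ∂Pr := by
  have hm : Measurable fun p : ((Unit ⊕ Fin d) × Fin n → ℝ) × (Fin d → ℝ) =>
      ENNReal.ofReal (qf P (blockSum p.1 p.2)) :=
    (measurable_qf_comp continuous_blockSum.measurable P).ennreal_ofReal
  have hm' : Measurable fun p : (Unit ⊕ Fin d) × Fin n → ℝ =>
      ENNReal.ofReal (qf (extCovar ν ⊗ₖ P) p) := (continuous_qf _).measurable.ennreal_ofReal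
  have h1 := lintegral_map hm (hξ.prodMk hv) (μ := Pr)
  -- By independence the joint law is a product, so the noise can be integrated out first with `ξ`
  -- frozen.
  rw [← h1, h.map_prod_eq_prod_map_map hξ.aemeasurable hv.aemeasurable, hlaw,
    MeasureTheory.lintegral_prod _ hm.aemeasurable]
  simp only [lintegral_qf_blockSum hν hP]
  exact lintegral_map hm' hξ

/-- The expected stage cost at time `k`. -/
noncomputable def stageCost (S : Sys n m d) (Pr : Measure Ω) (w : ℕ → Ω → Fin d → ℝ)
    (Q : Matrix (Fin n) (Fin n) ℝ) (R : Matrix (Fin m) (Fin m) ℝ) (x₀ : Fin n → ℝ)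
    (u : ℕ → Ω → Fin m → ℝ) (k : ℕ) : ℝ≥0∞ :=
  ∫⁻ ω, ENNReal.ofReal (qf Q (S.state w x₀ u k ω) + qf R (u k ω)) ∂Pr

/-- The expected loss at time `k` incurred by deviating from the feedback with gain
`gain S ν R P`. -/
noncomputable def gapCost (S : Sys n m d) (Pr : Measure Ω) (ν : Measure (Fin d → ℝ))
    (w : ℕ → Ω → Fin d → ℝ) (R : Matrix (Fin m) (Fin m) ℝ) (P : Matrix (Fin n) (Fin n) ℝ)
    (x₀ : Fin n → ℝ) (u : ℕ → Ω → Fin m → ℝ) (k : ℕ) : ℝ≥0∞ :=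
  ∫⁻ ω, ENNReal.ofReal (qf (R + G S ν P) (u k ω - gain S ν R P *ᵥ S.state w x₀ u k ω)) ∂Pr

/-- The expected value of the quadratic form of `P` at time `k`. -/
noncomputable def valueAt (S : Sys n m d) (Pr : Measure Ω) (w : ℕ → Ω → Fin d → ℝ)
    (P : Matrix (Fin n) (Fin n) ℝ) (x₀ : Fin n → ℝ) (u : ℕ → Ω → Fin m → ℝ) (k : ℕ) : ℝ≥0∞ :=
  ∫⁻ ω, ENNReal.ofReal (qf P (S.state w x₀ u k ω)) ∂Pr

theorem Admissible.measurable_input (hu : Admissible Pr w u) (k : ℕ) : Measurable (u k) := by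
  obtain ⟨ℱ, -, -, h⟩ := hu
  exact (h k).mono (ℱ.le k) le_rfl

theorem Admissible.measurable_state (hu : Admissible Pr w u) (k : ℕ) :
    Measurable (S.state w x₀ u k) := by
  obtain ⟨ℱ, hw, -, h⟩ := hu
  exact (MultNoise.measurable_state hw h k).mono (ℱ.le k) le_rfl

/-- State and input at time `k` are `ℱ k`-measurable, hence jointly independent of `w k`. -/
theorem Admissible.valueAt_succ [IsProbabilityMeasure Pr] [IsProbabilityMeasure ν]
    (hν : MemLp id 2 ν) (hP : P.PosSemidef) (hw_meas : ∀ k, Measurable (w k))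
    (hw_law : ∀ k, Pr.map (w k) = ν) (hu : Admissible Pr w u) (k : ℕ) :
    valueAt S Pr w P x₀ u (k + 1)
      = ∫⁻ ω, ENNReal.ofReal (qf (extCovar ν ⊗ₖ P)
          (stack S.A₀ S.A *ᵥ S.state w x₀ u k ω + stack S.B₀ S.B *ᵥ u k ω)) ∂Pr := by
  obtain ⟨ℱ, hw, hind, h⟩ := hu
  have hm : Measurable[ℱ k] fun ω =>
      stack S.A₀ S.A *ᵥ S.state w x₀ u k ω + stack S.B₀ S.B *ᵥ u k ω :=
    (continuous_drift S).measurable.comp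
      (Measurable.prodMk (MultNoise.measurable_state hw h k) (h k))
  simp only [valueAt, state_succ]
  refine lintegral_qf_blockSum_of_indep hν hP (hm.mono (ℱ.le k) le_rfl) (hw_meas k) ?_ (hw_law k)
  rw [IndepFun_iff_Indep]
  exact indep_of_indep_of_le_left (hind k) hm.comap_le

/-- This is the mean of the pointwise identity `Riccati.oneStep_eq`. Written without subtraction in
`[0, ∞]`, it needs no finiteness of moments. -/
theorem stageCost_add_valueAt [IsProbabilityMeasure Pr] [IsProbabilityMeasure ν]
    (hν : MemLp id 2 ν) (hQ : Q.PosDef) (hR : R.PosDef) (hP : P.PosSemidef)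
    (hric : Riccati S ν Q R P) (hw_meas : ∀ k, Measurable (w k))
    (hw_law : ∀ k, Pr.map (w k) = ν) (hu : Admissible Pr w u) (k : ℕ) :
    stageCost S Pr w Q R x₀ u k + valueAt S Pr w P x₀ u (k + 1)
      = valueAt S Pr w P x₀ u k + gapCost S Pr ν w R P x₀ u k := by
  have hx := hu.measurable_state (S := S) (x₀ := x₀) k
  have hu' := hu.measurable_input k
  have hqx : ∀ M : Matrix (Fin n) (Fin n) ℝ, Measurable fun ω => qf M (S.state w x₀ u k ω) :=
    fun M => measurable_qf_comp hx M
  have hqu : Measurable fun ω => qf Q (S.state w x₀ u k ω) + qf R (u k ω) :=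
    (hqx Q).add (measurable_qf_comp hu' R)
  rw [hu.valueAt_succ hν hP hw_meas hw_law, stageCost, valueAt, gapCost,
    ← lintegral_add_left hqu.ennreal_ofReal,
    ← lintegral_add_left (hqx P).ennreal_ofReal]
  refine lintegral_congr fun ω => ?_
  rw [← ENNReal.ofReal_add (add_nonneg (qf_nonneg hQ.posSemidef _) (qf_nonneg hR.posSemidef _))
      (qf_nonneg (kronecker_posSemidef hν hP) _),
    ← ENNReal.ofReal_add (qf_nonneg hP _) (qf_nonneg (posDef_add_G hν hR hP).posSemidef _),
    ← hric.oneStep_eq hν hR hP, oneStep]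

theorem sum_stageCost_add_valueAt [IsProbabilityMeasure Pr] [IsProbabilityMeasure ν]
    (hν : MemLp id 2 ν) (hQ : Q.PosDef) (hR : R.PosDef) (hP : P.PosSemidef)
    (hric : Riccati S ν Q R P) (hw_meas : ∀ k, Measurable (w k))
    (hw_law : ∀ k, Pr.map (w k) = ν) (hu : Admissible Pr w u) (N : ℕ) :
    ∑ k ∈ Finset.range N, stageCost S Pr w Q R x₀ u k + valueAt S Pr w P x₀ u N
      = ENNReal.ofReal (qf P x₀) + ∑ k ∈ Finset.range N, gapCost S Pr ν w R P x₀ u k := by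
  induction N with
  | zero => simp [valueAt, Sys.state]
  | succ N ih =>
    rw [Finset.sum_range_succ, add_assoc,
      stageCost_add_valueAt hν hQ hR hP hric hw_meas hw_law hu, ← add_assoc, ih, add_assoc,
      ← Finset.sum_range_succ]

theorem cost_eq_tsum (hu : Admissible Pr w u) :
    cost S Pr w Q R x₀ u = ∑' k, stageCost S Pr w Q R x₀ u k := by
  rw [cost, lintegral_tsum fun k => ?_]
  · rfl
  · exact ((measurable_qf_comp (hu.measurable_state k) Q).add
      (measurable_qf_comp (hu.measurable_input k) R)).ennreal_ofReal.aemeasurable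

/-- Along an input of finite cost, every quadratic form of the state tends to `0` in mean. -/
theorem tendsto_valueAt (hQ : Q.PosDef) (hR : R.PosSemidef) (hu : Admissible Pr w u)
    (hfin : cost S Pr w Q R x₀ u ≠ ∞) (M : Matrix (Fin n) (Fin n) ℝ) :
    Tendsto (valueAt S Pr w M x₀ u) atTop (𝓝 0) := by
  -- The form of `M` is at most `c` times the stage cost, and the expected stage costs are terms of
  -- a finite series.
  obtain ⟨c, hc1, hc⟩ := exists_qf_le hQ M
  have h0 : Tendsto (stageCost S Pr w Q R x₀ u) atTop (𝓝 0) :=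
    ENNReal.tendsto_atTop_zero_of_tsum_ne_top (by rwa [← cost_eq_tsum hu])
  have h1 := ENNReal.Tendsto.const_mul (a := ENNReal.ofReal c) h0 (Or.inr ENNReal.ofReal_ne_top)
  rw [mul_zero] at h1
  refine tendsto_of_tendsto_of_tendsto_of_le_of_le tendsto_const_nhds h1
    (fun k => zero_le) fun k => ?_
  simp only [valueAt, stageCost]
  rw [← lintegral_const_mul' _ _ ENNReal.ofReal_ne_top]
  refine lintegral_mono fun ω => ?_
  simp only
  rw [← ENNReal.ofReal_mul (by linarith)]
  refine ENNReal.ofReal_le_ofReal ((hc _).trans ?_)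
  exact mul_le_mul_of_nonneg_left (le_add_of_nonneg_right (qf_nonneg hR _)) (by linarith)

/-- The cost of an input is the optimal value plus the accumulated loss. -/
theorem cost_eq [IsProbabilityMeasure Pr] [IsProbabilityMeasure ν]
    (hν : MemLp id 2 ν) (hQ : Q.PosDef) (hR : R.PosDef) (hP : P.PosSemidef)
    (hric : Riccati S ν Q R P) (hw_meas : ∀ k, Measurable (w k))
    (hw_law : ∀ k, Pr.map (w k) = ν) (hu : Admissible Pr w u)
    (hfin : cost S Pr w Q R x₀ u ≠ ∞) :
    cost S Pr w Q R x₀ u = ENNReal.ofReal (qf P x₀) + ∑' k, gapCost S Pr ν w R P x₀ u k := by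
  -- Pass to the limit in the telescoped identity; finiteness of the cost removes the terminal
  -- value.
  have h1 := (ENNReal.tendsto_nat_tsum (stageCost S Pr w Q R x₀ u)).add
    (tendsto_valueAt hQ hR.posSemidef hu hfin P)
  have h2 := (ENNReal.tendsto_nat_tsum (gapCost S Pr ν w R P x₀ u)).const_add
    (ENNReal.ofReal (qf P x₀))
  rw [add_zero, ← cost_eq_tsum hu] at h1
  refine tendsto_nhds_unique h1 (h2.congr fun N => ?_)
  exact (sum_stageCost_add_valueAt hν hQ hR hP hric hw_meas hw_law hu N).symm

theorem le_cost [IsProbabilityMeasure Pr] [IsProbabilityMeasure ν]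
    (hν : MemLp id 2 ν) (hQ : Q.PosDef) (hR : R.PosDef) (hP : P.PosSemidef)
    (hric : Riccati S ν Q R P) (hw_meas : ∀ k, Measurable (w k))
    (hw_law : ∀ k, Pr.map (w k) = ν) (hu : Admissible Pr w u) :
    ENNReal.ofReal (qf P x₀) ≤ cost S Pr w Q R x₀ u := by
  by_cases hfin : cost S Pr w Q R x₀ u = ∞
  · simp [hfin]
  · rw [cost_eq hν hQ hR hP hric hw_meas hw_law hu hfin]
    exact le_self_add

end Cost

/-! ### Optimality, stability and uniqueness of the Riccati feedback. -/

section Feedback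

variable {n m d : ℕ} {Ω : Type*} [mΩ : MeasurableSpace Ω] {Pr : Measure Ω}
  {ν : Measure (Fin d → ℝ)} {w : ℕ → Ω → Fin d → ℝ}
  {S : Sys n m d} {Q : Matrix (Fin n) (Fin n) ℝ} {R : Matrix (Fin m) (Fin m) ℝ}
  {P : Matrix (Fin n) (Fin n) ℝ} {x₀ : Fin n → ℝ} {u : ℕ → Ω → Fin m → ℝ}

/-- The information contained in `w 0, …, w (k - 1)`. -/
def pastFiltration (hw_meas : ∀ k, Measurable (w k)) : Filtration ℕ mΩ where
  seq k := ⨆ j ∈ Set.Iio k, MeasurableSpace.comap (w j) inferInstance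
  mono' _ _ hij := biSup_mono fun _ hk => lt_of_lt_of_le hk hij
  le' _ := iSup₂_le fun j _ => (hw_meas j).comap_le

theorem measurable_autState {M₀ : Matrix (Fin n) (Fin n) ℝ}
    {M : Fin d → Matrix (Fin n) (Fin n) ℝ} {ℱ : Filtration ℕ mΩ}
    (hw : ∀ k, Measurable[ℱ (k + 1)] (w k)) (k : ℕ) :
    Measurable[ℱ k] (autState M₀ M w x₀ k) := by
  induction k with
  | zero => exact measurable_const
  | succ k ih =>
    have h1 : Measurable[ℱ (k + 1)] fun ω => stack M₀ M *ᵥ autState M₀ M w x₀ k ω :=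
      ((by fun_prop : Continuous fun x => stack M₀ M *ᵥ x).measurable.comp ih).mono
        (ℱ.mono k.le_succ) le_rfl
    have h2 := continuous_blockSum.measurable.comp (h1.prodMk (hw k))
    convert! h2 using 1
    ext1 ω
    simp only [Function.comp, blockSum_stack, autState]

theorem admissible_feedback (hw_meas : ∀ k, Measurable (w k)) (hw_indep : iIndepFun w Pr)
    (K : Matrix (Fin m) (Fin n) ℝ) : Admissible Pr w (S.feedback w K x₀) := by
  have hw : ∀ k, Measurable[pastFiltration hw_meas (k + 1)] (w k) := fun k =>
    (comap_measurable (w k)).mono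
      (le_iSup₂_of_le (f := fun j (_ : j ∈ Set.Iio (k + 1)) =>
        MeasurableSpace.comap (w j) inferInstance) k k.lt_succ_self le_rfl) le_rfl
  refine ⟨pastFiltration hw_meas, hw, fun k => ?_, fun k => ?_⟩
  -- The index sets `{j | j < k}` and `{k}` are disjoint, so the past is independent of `w k`.
  · have h := indep_iSup_of_disjoint (fun j => (hw_meas j).comap_le) hw_indep.iIndep
      (S := Set.Iio k) (T := {k}) (by simp)
    rwa [iSup_singleton] at h
  · exact (by fun_prop : Continuous fun x : Fin n → ℝ => K *ᵥ x).measurable.comp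
      (measurable_autState hw k)

theorem gapCost_feedback (k : ℕ) :
    gapCost S Pr ν w R P x₀ (S.feedback w (gain S ν R P) x₀) k = 0 := by
  simp only [gapCost, state_feedback, Sys.feedback, sub_self]
  simp [qf]

/-- With zero gaps the telescoped identity bounds every partial sum of stage costs. This proves
finiteness of the cost, which `cost_eq` would have to assume. -/
theorem cost_feedback [IsProbabilityMeasure Pr] [IsProbabilityMeasure ν]
    (hν : MemLp id 2 ν) (hQ : Q.PosDef) (hR : R.PosDef) (hP : P.PosSemidef)
    (hric : Riccati S ν Q R P) (hw_meas : ∀ k, Measurable (w k)) (hw_indep : iIndepFun w Pr)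
    (hw_law : ∀ k, Pr.map (w k) = ν) :
    cost S Pr w Q R x₀ (S.feedback w (gain S ν R P) x₀) ≤ ENNReal.ofReal (qf P x₀) := by
  have hu := admissible_feedback (S := S) (x₀ := x₀) hw_meas hw_indep (gain S ν R P)
  rw [cost_eq_tsum hu]
  refine ENNReal.tsum_le_of_sum_range_le fun N => ?_
  have h := sum_stageCost_add_valueAt (x₀ := x₀) hν hQ hR hP hric hw_meas hw_law hu N
  simp only [gapCost_feedback, Finset.sum_const_zero, add_zero] at h
  exact le_self_add.trans h.le

theorem isOptimal_feedback [IsProbabilityMeasure Pr] [IsProbabilityMeasure ν]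
    (hν : MemLp id 2 ν) (hQ : Q.PosDef) (hR : R.PosDef) (hP : P.PosSemidef)
    (hric : Riccati S ν Q R P) (hw_meas : ∀ k, Measurable (w k)) (hw_indep : iIndepFun w Pr)
    (hw_law : ∀ k, Pr.map (w k) = ν) :
    IsOptimal S Pr w Q R x₀ (S.feedback w (gain S ν R P) x₀) :=
  ⟨admissible_feedback hw_meas hw_indep _, fun _ hv =>
    (cost_feedback hν hQ hR hP hric hw_meas hw_indep hw_law).trans
      (le_cost hν hQ hR hP hric hw_meas hw_law hv)⟩

theorem msStable_feedback [IsProbabilityMeasure Pr] [IsProbabilityMeasure ν]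
    (hν : MemLp id 2 ν) (hQ : Q.PosDef) (hR : R.PosDef) (hP : P.PosSemidef)
    (hric : Riccati S ν Q R P) (hw_meas : ∀ k, Measurable (w k)) (hw_indep : iIndepFun w Pr)
    (hw_law : ∀ k, Pr.map (w k) = ν) :
    MSStable Pr w (S.cl₀ (gain S ν R P)) (S.cl (gain S ν R P)) := by
  intro x₀
  have hu := admissible_feedback (S := S) (x₀ := x₀) hw_meas hw_indep (gain S ν R P)
  have h := tendsto_valueAt hQ hR.posSemidef hu
    -- The identity matrix as test form turns `valueAt` into `E[xᵀ x]`.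
    ((cost_feedback hν hQ hR hP hric hw_meas hw_indep hw_law).trans_lt ENNReal.ofReal_lt_top).ne 1
  refine h.congr fun k => ?_
  simp only [valueAt, state_feedback, qf, Matrix.one_mulVec]

theorem ae_eq_gain_of_gapCost_eq_zero (hRG : (R + G S ν P).PosDef) (hu : Admissible Pr w u)
    {k : ℕ} (h : gapCost S Pr ν w R P x₀ u k = 0) :
    ∀ᵐ ω ∂Pr, u k ω = gain S ν R P *ᵥ S.state w x₀ u k ω := by
  have hm : Measurable fun ω => u k ω - gain S ν R P *ᵥ S.state w x₀ u k ω :=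
    (hu.measurable_input k).sub
      ((by fun_prop : Continuous fun x : Fin n → ℝ => gain S ν R P *ᵥ x).measurable.comp
        (hu.measurable_state k))
  rw [gapCost, lintegral_eq_zero_iff
    (measurable_qf_comp hm _).ennreal_ofReal] at h
  filter_upwards [h] with ω hω
  by_contra hne
  have h1 := (posDef_iff_qf.1 hRG).2 _ (sub_ne_zero.2 hne)
  exact absurd (ENNReal.ofReal_eq_zero.1 hω) (not_le.2 h1)

/-- Optimality leaves no room for a gap: the finite term `x₀ᵀ P x₀` cancels and all expected gaps
vanish. -/
theorem IsOptimal.ae_eq_feedback [IsProbabilityMeasure Pr] [IsProbabilityMeasure ν]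
    (hν : MemLp id 2 ν) (hQ : Q.PosDef) (hR : R.PosDef) (hP : P.PosSemidef)
    (hric : Riccati S ν Q R P) (hw_meas : ∀ k, Measurable (w k)) (hw_indep : iIndepFun w Pr)
    (hw_law : ∀ k, Pr.map (w k) = ν) (hu : IsOptimal S Pr w Q R x₀ u) (k : ℕ) :
    u k =ᵐ[Pr] S.feedback w (gain S ν R P) x₀ k := by
  obtain ⟨hadm, hopt⟩ := hu
  have hle := (hopt _ (admissible_feedback hw_meas hw_indep (gain S ν R P))).trans
    (cost_feedback hν hQ hR hP hric hw_meas hw_indep hw_law)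
  rw [cost_eq hν hQ hR hP hric hw_meas hw_law hadm (hle.trans_lt ENNReal.ofReal_lt_top).ne] at hle
  have hsum : ∑' k, gapCost S Pr ν w R P x₀ u k = 0 :=
    le_zero_iff.1 (ENNReal.le_of_add_le_add_left ENNReal.ofReal_ne_top (by simpa using hle))
  have hgap : ∀ k, ∀ᵐ ω ∂Pr, u k ω = gain S ν R P *ᵥ S.state w x₀ u k ω := fun k =>
    ae_eq_gain_of_gapCost_eq_zero (posDef_add_G hν hR hP) hadm (ENNReal.tsum_eq_zero.1 hsum k)
  -- One null set serves all times, so off it the trajectory can be identified with the closed loop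
  -- by induction.
  filter_upwards [ae_all_iff.2 hgap] with ω hω
  have hstate : ∀ k, S.state w x₀ u k ω
      = autState (S.cl₀ (gain S ν R P)) (S.cl (gain S ν R P)) w x₀ k ω := by
    intro k
    induction k with
    | zero => rfl
    | succ k ih =>
      rw [Sys.state, autState, affine_cl, hω k, ih, Matrix.add_mulVec, Matrix.mulVec_mulVec]
  rw [hω k, hstate k, Sys.feedback]

end Feedback

end MultNoise

theorem mainTheorem4 {n m d : ℕ} {Ω : Type*} [MeasurableSpace Ω]
    (Pr : Measure Ω) [IsProbabilityMeasure Pr]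
    (ν : Measure (Fin d → ℝ)) [IsProbabilityMeasure ν] (hν : MemLp id 2 ν)
    (w : ℕ → Ω → Fin d → ℝ) (hw_meas : ∀ k, Measurable (w k))
    (hw_indep : iIndepFun w Pr) (hw_law : ∀ k, Pr.map (w k) = ν)
    (S : MultNoise.Sys n m d)
    (Q : Matrix (Fin n) (Fin n) ℝ) (hQ : Q.PosDef)
    (R : Matrix (Fin m) (Fin m) ℝ) (hR : R.PosDef)
    (hS : MultNoise.Stabilizable S ν) :
    ∃ P : Matrix (Fin n) (Fin n) ℝ,
      -- the Riccati equation has `P` as its unique positive semidefinite solution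
      P.PosDef ∧ MultNoise.Riccati S ν Q R P ∧
      (∀ P' : Matrix (Fin n) (Fin n) ℝ, P'.PosSemidef → MultNoise.Riccati S ν Q R P' → P' = P) ∧
      -- from every initial state, the feedback with gain `-(R + G(P))⁻¹ H(P)` is the optimal input
      (∀ x₀ : Fin n → ℝ,
        MultNoise.IsOptimal S Pr w Q R x₀ (S.feedback w (MultNoise.gain S ν R P) x₀) ∧
        ∀ v, MultNoise.IsOptimal S Pr w Q R x₀ v →
          ∀ k, v k =ᵐ[Pr] S.feedback w (MultNoise.gain S ν R P) x₀ k) ∧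
      -- this gain is mean square stabilizing
      MultNoise.MSStable Pr w (S.cl₀ (MultNoise.gain S ν R P)) (S.cl (MultNoise.gain S ν R P)) ∧
      (∃ P' : Matrix (Fin n) (Fin n) ℝ, MultNoise.Lyapunov ν
        (S.cl₀ (MultNoise.gain S ν R P)) (S.cl (MultNoise.gain S ν R P)) P') ∧
      -- `P` is the unique solution of the semidefinite program
      (∀ P' : Matrix (Fin n) (Fin n) ℝ, MultNoise.IsSdpSolution S ν Q R P' ↔ P' = P) := by
  obtain ⟨P, hP, hric⟩ := MultNoise.exists_riccati hν hQ hR hS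
  have hlyap := hric.lyapunov hν hQ hR hP
  exact ⟨P, hlyap.1, hric, fun P' hP' h' => hric.unique hν hQ hR hP hP' h',
    fun x₀ => ⟨MultNoise.isOptimal_feedback hν hQ hR hP hric hw_meas hw_indep hw_law,
      fun v hv k => hv.ae_eq_feedback hν hQ hR hP hric hw_meas hw_indep hw_law k⟩,
    MultNoise.msStable_feedback hν hQ hR hP hric hw_meas hw_indep hw_law,
    ⟨P, hlyap⟩, fun P' => hric.isSdpSolution_iff hν hQ hR hP⟩
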